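/- Let $m>1$ and $s>1$ be integers, let $X=\{0,\dots,m-1\}$, and let $T$ be the $m$-regular rooted tree, whose vertices are the finite words over $X$. For $a\in\operatorname{Aut}(T)$ and a word $u$, the section $a|_u\in\operatorname{Aut}(T)$ is defined by $a(uv)=a(u)\,a|_u(v)$ for all words $v$, and the label $a|^u\in\operatorname{Sym}(X)$ is the action of $a|_u$ on $X$. Fix an $m$-cycle $\sigma\in\operatorname{Sym}(X)$ and let $\Gamma\le\operatorname{Aut}(T)$ be the group of all automorphisms whose labels all lie in $\langle\sigma\rangle$. For $G\le\operatorname{Aut}(T)$ let $\mathrm{St}_G(n)$ be the subgroup of elements of $G$ fixing all words of length $n$, and for $G\le\Gamma$ put $$\dim_{\mathcal H}G=\liminf_{n\to\infty}\frac{\log_m|G/\mathrm{St}_G(n)|}{\log_m|\Gamma/\mathrm{St}_\Gamma(n)|}.$$ Write $g=\pi\,(g_x)_{x\in X}$ for the automorphism with label $\pi$ at the root and sections $g_x$ at the vertices $x\in X$. Define monomorphisms $\beta_0,\dots,\beta_{s-1}:\operatorname{Aut}(T)\to\operatorname{Aut}(T)$ by $$\beta_0(g)=g|^{\epsilon}\,(\beta_{s-1}(g|_0),\dots,\beta_{s-1}(g|_{m-1})),\qquad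 \beta_i(g)=(\beta_{i-1}(g),\mathrm{id},\dots,\mathrm{id})\quad(1\le i\le s-1),$$ and let $\mathrm{Bas}_s(G)=\langle\beta_i(g)\mid g\in G,\ 0\le i\le s-1\rangle$ be the $s$-th Basilica group of $G$. Let $N_{s-1}$ be the normal closure of $\langle\beta_j(G)\mid 0\le j<s-1\rangle$ in $\mathrm{Bas}_s(G)$, and let $K_{s-1}=\beta_{s-1}^{-1}(\beta_{s-1}(G)\cap N_{s-1})\le G$. Let $G\le\Gamma$ satisfy the following conditions. 1. $G$ is very strongly fractal: $G$ acts transitively on the set of words of each length, and $\{g|_x\mid g\in\mathrm{St}_G(n+1)\}=\mathrm{St}_G(n)$ for all $n\ge 0$ and $x\in X$. 2. $G$ is self-similar: $g|_u\in G$ for all $g\in G$ and all words $u$. 3. $G$ is weakly regular branch over $K_{s-1}$ (which may be trivial): for all $(k_x)_{x\in X}\in K_{s-1}^{X}$ there is $g\in\mathrm{St}_{K_{s-1}}(1)$ with $g|_x=k_x$ for all $x\in X$. 4. $\dim_{\mathcal H}G<1$. Then $$\dim_{\mathcal H}G<\dim_{\mathcal H}\mathrm{Bas}_s(G).$$ 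-/

import Mathlib

namespace Basilica

open Filter

/-- The automorphism group of the `m`-regular rooted tree `T`. The vertices are the finite words over
`X = Fin m`, the empty word is the root, the words of length `n` form the `n`-th layer, and `u` is
an ancestor of `v` iff `u` is a prefix of `v`. The product is composition: `(a * b) u = a (b u)`. -/
def treeAut (m : ℕ) : Subgroup (Equiv.Perm (List (Fin m))) where
  carrier := {a | (∀ u, (a u).length = u.length) ∧ ∀ u v, a u <+: a v ↔ u <+: v}
  one_mem' := by simp
  mul_mem' := by
    rintro a b ⟨ha, ha'⟩ ⟨hb, hb'⟩
    exact ⟨fun u => by simp [ha, hb], fun u v => by simp [ha', hb']⟩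
  inv_mem' := by
    rintro a ⟨ha, ha'⟩
    refine ⟨fun u => ?_, fun u v => ?_⟩
    · rw [← ha]; simp
    · rw [← ha']; simp

/-- `Aut(T)` as a type. -/
abbrev TreeAut (m : ℕ) : Type := treeAut m

variable {m : ℕ}

instance : CoeFun (TreeAut m) (fun _ => List (Fin m) → List (Fin m)) := ⟨fun a => a.1⟩

theorem mul_apply (a b : TreeAut m) (u : List (Fin m)) : (a * b) u = a (b u) := rfl

theorem one_apply (u : List (Fin m)) : (1 : TreeAut m) u = u := rfl

theorem inv_apply_self (a : TreeAut m) (u : List (Fin m)) : a⁻¹ (a u) = u := by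
  rw [← mul_apply, inv_mul_cancel, one_apply]

theorem apply_inv_self (a : TreeAut m) (u : List (Fin m)) : a (a⁻¹ u) = u := by
  rw [← mul_apply, mul_inv_cancel, one_apply]

theorem length_apply (a : TreeAut m) (u : List (Fin m)) : (a u).length = u.length := a.2.1 u

theorem prefix_iff (a : TreeAut m) (u v : List (Fin m)) : a u <+: a v ↔ u <+: v := a.2.2 u v

theorem ext_apply {a b : TreeAut m} (h : ∀ u, a u = b u) : a = b :=
  Subtype.ext (Equiv.ext h)

theorem apply_append (a : TreeAut m) (u v : List (Fin m)) :
    a (u ++ v) = a u ++ (a (u ++ v)).drop u.length := by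
  obtain ⟨w, hw⟩ := (prefix_iff a u (u ++ v)).2 (List.prefix_append u v)
  rw [← hw, List.drop_left' (length_apply a u)]

theorem inv_apply_append (a : TreeAut m) (u v : List (Fin m)) :
    a⁻¹ (a u ++ v) = u ++ (a⁻¹ (a u ++ v)).drop u.length := by
  have h := apply_append a⁻¹ (a u) v
  rwa [inv_apply_self, length_apply] at h

/-- The section `a|_u` of `a` at the vertex `u`: the automorphism with
`a (u v) = a(u) a|_u(v)` for all words `v`. -/
def sec (a : TreeAut m) (u : List (Fin m)) : TreeAut m :=
  ⟨{ toFun := fun v => (a (u ++ v)).drop u.length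
     invFun := fun v => (a⁻¹ (a u ++ v)).drop u.length
     left_inv := fun v => by
       dsimp only
       rw [← apply_append, inv_apply_self, List.drop_left' rfl]
     right_inv := fun v => by
       dsimp only
       rw [← inv_apply_append, apply_inv_self, List.drop_left' (length_apply a u)] },
   fun v => by simp [length_apply],
   fun v w => by
     have h := prefix_iff a (u ++ v) (u ++ w)
     rw [apply_append a u v, apply_append a u w, List.prefix_append_right_inj,
       List.prefix_append_right_inj] at h
     exact h⟩

theorem apply_append_sec (a : TreeAut m) (u v : List (Fin m)) :
    a (u ++ v) = a u ++ sec a u v := apply_append a u v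

theorem sec_mul (a b : TreeAut m) (u : List (Fin m)) :
    sec (a * b) u = sec a (b u) * sec b u := by
  refine ext_apply fun v => ?_
  have h := apply_append_sec (a * b) u v
  rw [mul_apply, mul_apply, apply_append_sec b, apply_append_sec a] at h
  exact (List.append_cancel_left h).symm

theorem sec_one (u : List (Fin m)) : sec (1 : TreeAut m) u = 1 := by
  refine ext_apply fun v => ?_
  have h := apply_append_sec 1 u v
  exact (List.append_cancel_left h).symm

theorem ne_nil_apply (a : TreeAut m) (x : Fin m) : a [x] ≠ [] := by
  have := length_apply a [x]
  intro h
  simp [h] at this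

/-- The action of `a` on the first layer, as a map on `X`. -/
def first (a : TreeAut m) (x : Fin m) : Fin m := (a [x]).head (ne_nil_apply a x)

theorem apply_singleton (a : TreeAut m) (x : Fin m) : a [x] = [first a x] := by
  have h := length_apply a [x]
  obtain ⟨y, hy⟩ := List.length_eq_one_iff.1 h
  simp [first, hy]

theorem first_mul (a b : TreeAut m) (x : Fin m) : first (a * b) x = first a (first b x) := by
  have h := apply_singleton (a * b) x
  rw [mul_apply, apply_singleton b, apply_singleton a] at h
  simpa using h.symm

theorem first_one (x : Fin m) : first (1 : TreeAut m) x = x := by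
  have h := apply_singleton 1 x
  rw [one_apply] at h
  simpa using h.symm

/-- The label `a|^u` of `a` at the vertex `u`: the permutation of `X` by which the section of `a`
at `u` acts on the first layer. -/
def label (a : TreeAut m) (u : List (Fin m)) : Equiv.Perm (Fin m) where
  toFun := first (sec a u)
  invFun := first (sec a u)⁻¹
  left_inv x := by rw [← first_mul, inv_mul_cancel, first_one]
  right_inv x := by rw [← first_mul, mul_inv_cancel, first_one]

theorem apply_concat (a : TreeAut m) (u : List (Fin m)) (x : Fin m) :
    a (u ++ [x]) = a u ++ [label a u x] := by
  rw [apply_append_sec, apply_singleton]; rfl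

theorem label_mul (a b : TreeAut m) (u : List (Fin m)) :
    label (a * b) u = label a (b u) * label b u := by
  ext x
  simp only [label, Equiv.coe_fn_mk, Equiv.Perm.coe_mul, Function.comp, sec_mul, first_mul]

theorem label_one (u : List (Fin m)) : label (1 : TreeAut m) u = 1 := by
  ext x
  simp only [label, Equiv.coe_fn_mk, Equiv.Perm.coe_one, id, sec_one, first_one]

theorem apply_nil (a : TreeAut m) : a [] = [] := by
  rw [← List.length_eq_zero_iff, length_apply]; rfl

theorem apply_cons_nil (a : TreeAut m) (x : Fin m) : a [x] = [label a [] x] := by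
  have h := apply_concat a [] x
  rwa [apply_nil, List.nil_append, List.nil_append] at h

/-- The layer stabiliser `St(n)` in `Aut(T)`: the automorphisms fixing every word of length `n`. -/
def layerStab (m n : ℕ) : Subgroup (TreeAut m) where
  carrier := {a | ∀ u : List (Fin m), u.length = n → a u = u}
  one_mem' := fun _ _ => rfl
  mul_mem' := fun {a b} ha hb u hu => by rw [mul_apply, hb u hu, ha u hu]
  inv_mem' := fun {a} ha u hu => by
    conv_lhs => rw [← ha u hu]
    exact inv_apply_self a u

/-- The layer stabiliser `St_G(n)` of `G`. -/
def St (G : Subgroup (TreeAut m)) (n : ℕ) : Subgroup (TreeAut m) := G ⊓ layerStab m n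

/-- `G` acts transitively on every layer. -/
def SphericallyTransitive (G : Subgroup (TreeAut m)) : Prop :=
  ∀ u v : List (Fin m), u.length = v.length → ∃ g ∈ G, g u = v

/-- `G` contains all sections of its elements. -/
def SelfSimilar (G : Subgroup (TreeAut m)) : Prop :=
  ∀ g ∈ G, ∀ v : List (Fin m), sec g v ∈ G

/-- `G` is spherically transitive and `St_G(n+1)|_x = St_G(n)` for all `n ≥ 0` and `x ∈ X`. -/
def VeryStronglyFractal (G : Subgroup (TreeAut m)) : Prop :=
  SphericallyTransitive G ∧
    ∀ (n : ℕ) (x : Fin m),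
      (fun g => sec g [x]) '' (St G (n + 1) : Set (TreeAut m)) = (St G n : Set (TreeAut m))

/-- `G` is weakly regular branch over `H`: `H ≤ G` and `H × ⋯ × H ≤ ψ₁(St_H(1))`, where
`ψ₁(g) = (g|_x)_{x ∈ X}`. The subgroup `H` may be trivial. -/
def WeaklyRegularBranchOver (G H : Subgroup (TreeAut m)) : Prop :=
  H ≤ G ∧ ∀ h : Fin m → TreeAut m, (∀ x, h x ∈ H) → ∃ g ∈ St H 1, ∀ x, sec g [x] = h x

/-- `Γ(P)`: the automorphisms all of whose labels lie in `P ≤ Sym(X)`. -/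
def Gam (P : Subgroup (Equiv.Perm (Fin m))) : Subgroup (TreeAut m) where
  carrier := {a | ∀ u, label a u ∈ P}
  one_mem' := fun u => by rw [label_one]; exact P.one_mem
  mul_mem' := fun {a b} ha hb u => by rw [label_mul]; exact P.mul_mem (ha _) (hb _)
  inv_mem' := fun {a} ha u => by
    have h : label a (a⁻¹ u) * label a⁻¹ u = 1 := by rw [← label_mul, mul_inv_cancel, label_one]
    rw [← inv_eq_of_mul_eq_one_right h]
    exact P.inv_mem (ha _)

/-- The action on words of the maps `β_i`, `0 ≤ i < s`:
`β_0(g) = g|^ε (β_{s-1}(g|_0), …, β_{s-1}(g|_{m-1}))` and `β_i(g) = (β_{i-1}(g), id, …, id)` for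
`1 ≤ i ≤ s - 1`. -/
def betaFun (s : ℕ) : ℕ → TreeAut m → List (Fin m) → List (Fin m)
  | _, _, [] => []
  | 0, g, x :: v => label g [] x :: betaFun s (s - 1) (sec g [x]) v
  | i + 1, g, x :: v => if (x : ℕ) = 0 then x :: betaFun s i g v else x :: v

theorem betaFun_length (s : ℕ) (v : List (Fin m)) :
    ∀ (i : ℕ) (g : TreeAut m), (betaFun s i g v).length = v.length := by
  induction v with
  | nil => intro i g; simp [betaFun]
  | cons x v ih =>
    rintro (_ | i) g
    · simp [betaFun, ih]
    · simp only [betaFun]; split_ifs <;> simp [ih]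

theorem betaFun_one (s : ℕ) (v : List (Fin m)) : ∀ i : ℕ, betaFun s i 1 v = v := by
  induction v with
  | nil => intro i; simp [betaFun]
  | cons x v ih =>
    rintro (_ | i)
    · simp [betaFun, label_one, sec_one, ih]
    · simp [betaFun, ih]

theorem betaFun_mul (s : ℕ) (v : List (Fin m)) : ∀ (i : ℕ) (g h : TreeAut m),
    betaFun s i (g * h) v = betaFun s i g (betaFun s i h v) := by
  induction v with
  | nil => intro i g h; simp [betaFun]
  | cons x v ih =>
    rintro (_ | i) g h
    · simp [betaFun, label_mul, sec_mul, ih, apply_nil, apply_cons_nil]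
    · simp only [betaFun]; split_ifs with hx <;> simp [betaFun, hx, ih]

theorem betaFun_append (s : ℕ) (u : List (Fin m)) : ∀ (i : ℕ) (g : TreeAut m) (v : List (Fin m)),
    betaFun s i g u <+: betaFun s i g (u ++ v) := by
  induction u with
  | nil => intro i g v; simp [betaFun]
  | cons x u ih =>
    rintro (_ | i) g v
    · simp [betaFun, ih]
    · simp only [betaFun, List.cons_append]; split_ifs <;> simp [ih]

theorem betaFun_prefix (s i : ℕ) (g : TreeAut m) {u v : List (Fin m)} (h : u <+: v) :
    betaFun s i g u <+: betaFun s i g v := by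
  obtain ⟨w, rfl⟩ := h
  exact betaFun_append s u i g w

theorem betaFun_inv (s i : ℕ) (g : TreeAut m) (v : List (Fin m)) :
    betaFun s i g⁻¹ (betaFun s i g v) = v := by
  rw [← betaFun_mul, inv_mul_cancel, betaFun_one]

/-- The homomorphism `β_i = β_i^s : Aut(T) → Aut(T)`. -/
def beta (s i : ℕ) : TreeAut m →* TreeAut m where
  toFun g :=
    ⟨{ toFun := betaFun s i g
       invFun := betaFun s i g⁻¹
       left_inv := betaFun_inv s i g
       right_inv := fun v => by simpa using betaFun_inv s i g⁻¹ v },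
     fun u => betaFun_length s u i g,
     fun u v => ⟨fun h => by
       have h' := betaFun_prefix s i g⁻¹ h
       simpa [betaFun_inv] using h', fun h => betaFun_prefix s i g h⟩⟩
  map_one' := ext_apply fun v => betaFun_one s v i
  map_mul' g h := ext_apply fun v => betaFun_mul s v i g h

/-- The `s`-th Basilica group of `G`, generated by all `β_i(g)` with `g ∈ G` and `0 ≤ i ≤ s - 1`. -/
def Bas (s : ℕ) (G : Subgroup (TreeAut m)) : Subgroup (TreeAut m) :=
  Subgroup.closure {b | ∃ i < s, ∃ g ∈ G, b = beta s i g}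

/-- `S_i = ⟨β_j(G) ∣ j ≠ i⟩`. -/
def splitS (s : ℕ) (G : Subgroup (TreeAut m)) (i : ℕ) : Subgroup (TreeAut m) :=
  Subgroup.closure {b | ∃ j < s, j ≠ i ∧ ∃ g ∈ G, b = beta s j g}

/-- `N_i`: the normal closure of `S_i` in the `s`-th Basilica group of `G`. -/
def splitN (s : ℕ) (G : Subgroup (TreeAut m)) (i : ℕ) : Subgroup (TreeAut m) :=
  (Subgroup.normalClosure ((splitS s G i).subgroupOf (Bas s G) : Set (Bas s G))).map
    (Bas s G).subtype

/-- The `i`-th splitting kernel `K_i = β_i⁻¹(β_i(G) ∩ N_i)` of `G`. -/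
def splitK (s : ℕ) (G : Subgroup (TreeAut m)) (i : ℕ) : Subgroup (TreeAut m) :=
  (G.map (beta s i) ⊓ splitN s G i).comap (beta s i)

/-- The order of the congruence quotient `G / St_G(n)`. -/
noncomputable def congOrder (G : Subgroup (TreeAut m)) (n : ℕ) : ℕ :=
  Nat.card (G ⧸ (St G n).subgroupOf G)

/-- The Hausdorff dimension of `G` relative to `Γ`. -/
noncomputable def dimH (Γ G : Subgroup (TreeAut m)) : ℝ :=
  liminf (fun n : ℕ => Real.logb m (congOrder G n) / Real.logb m (congOrder Γ n)) atTop

end Basilica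

/-! Let γ_n, d_n, b_n be the base-m logarithms of the orders of the n-th congruence quotients of Γ,
G and Bas_s(G). Then γ_{n+1} = mγ_n + 1, while G falls short of this recursion by a loss o_n = m d_n
+ 1 - d_{n+1} ≥ 0. The normalised deficit e_n = (γ_n - d_n)/m^n grows by o_n/m^{n+1} and stays
bounded, so it has a limit E. Hence dim G = 1 - (m-1)E, and dim G < 1 means E > 0.

The Basilica group loses at most o_{⌊n/s⌋} at step n (`congOrder_Bas_succ`). Indeed Bas^m is the
product of β_{s-1}(G)^m and the group of first-layer sections of St_Bas(1)
(`exists_beta_inv_mul_mem_rigidSections`). Through β_0 the latter contains the β_{s-1}-image of the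
sections of St_G(1), so Bas loses no more index than G does (`relIndex_mul_le`). Since β_{s-1}
stretches one level into s levels, level n of Bas only sees level ⌊n/s⌋ of G.

Thus o_j is charged to Bas with the weights m^{-(sj+1)}, …, m^{-(sj+s)}, and to G with the weight
m^{-(j+1)}. For j ≥ 1 the former add up to at most 3/4 of the latter (`block_coefficient_le`), and
o_0 = 0 because d_1 = 1. So the normalised deficit of Bas is at most 3E/4 (`defect_le`), which gives
dim Bas ≥ 1 - (3/4)(m-1)E > dim G. -/

namespace Basilica

open Subgroup

/-! ### Relative index inequalities. -/

section Index

variable {P Q : Type*} [Group P] [Group Q]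

theorem relIndex_ne_zero_of_finiteIndex (H K : Subgroup P) [H.FiniteIndex] : H.relIndex K ≠ 0 :=
  mt index_eq_zero_of_relIndex_eq_zero FiniteIndex.index_ne_zero

theorem finiteIndex_comap (f : P →* Q) (H : Subgroup Q) [H.FiniteIndex] :
    (H.comap f).FiniteIndex :=
  ⟨by rw [index_comap]; exact relIndex_ne_zero_of_finiteIndex H _⟩

theorem relIndex_pi {ι : Type*} [Fintype ι] (L H : Subgroup P) :
    (Subgroup.pi Set.univ fun _ : ι => L).relIndex (Subgroup.pi Set.univ fun _ : ι => H) =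
      L.relIndex H ^ Fintype.card ι := by
  let f : (ι → H) →* (ι → P) :=
    { toFun := fun h i => h i
      map_one' := rfl
      map_mul' := fun _ _ => rfl }
  have hH : (Subgroup.pi Set.univ fun _ : ι => H) = Subgroup.map f ⊤ := by
    ext h
    simp only [Subgroup.mem_pi, Set.mem_univ, true_imp_iff, Subgroup.mem_map, Subgroup.mem_top,
      true_and]
    exact ⟨fun hh => ⟨fun i => ⟨h i, hh i⟩, rfl⟩, by rintro ⟨k, rfl⟩ i; exact (k i).2⟩
  have hL : Subgroup.comap f (Subgroup.pi Set.univ fun _ : ι => L) =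
      Subgroup.pi Set.univ fun _ : ι => L.subgroupOf H := by
    ext h
    simp [Subgroup.mem_pi, Subgroup.mem_subgroupOf, f]
  rw [hH, ← relIndex_comap, hL, relIndex_top_right, index_pi]
  simp [relIndex]

/-- If the elements of `B` are congruent to elements of `f(G)` modulo `C` on the right, then
`|B : B ∩ M| ≤ |G : G ∩ f⁻¹(M)|` for every `M ≥ C`. -/
theorem relIndex_le_relIndex_comap (f : P →* Q) {G : Subgroup P} {B C M : Subgroup Q}
    (hB : ∀ b ∈ B, ∃ g ∈ G, (f g)⁻¹ * b ∈ C) [M.FiniteIndex] (hM : C ≤ M) :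
    M.relIndex B ≤ (M.comap f).relIndex G := by
  choose r hrG hr using hB
  have : (M.comap f).FiniteIndex := finiteIndex_comap f M
  refine Nat.card_le_card_of_injective
    (fun q : B ⧸ M.subgroupOf B =>
      ((⟨r q.out.1 q.out.2, hrG _ _⟩ : G) : G ⧸ (M.comap f).subgroupOf G)) ?_
  intro p q hpq
  rw [← p.out_eq', ← q.out_eq']
  have h := QuotientGroup.eq.1 hpq
  refine QuotientGroup.eq.2 ?_
  simp only [mem_subgroupOf, mem_comap, coe_mul, coe_inv, map_mul, map_inv] at h ⊢
  have h1 := M.mul_mem (M.mul_mem (M.inv_mem (hM (hr p.out.1 p.out.2))) h)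
    (hM (hr q.out.1 q.out.2))
  simpa [mul_assoc] using h1

/-- Modulo finite-index subgroups this says |B : C| ≤ |G : D|. It holds because B ⊆ f(G)C and f(D) ≤
C, so cosets of D in G surject onto those of C in B; the remaining factors come from Lagrange's
theorem along N ≤ CN and L ≤ ⟨D, L⟩. -/
theorem relIndex_mul_le {f : P →* Q} {G D L : Subgroup P} {B C N : Subgroup Q}
    [L.FiniteIndex] [N.Normal] [N.FiniteIndex]
    (hDG : D ≤ G) (hL : L ≤ N.comap f) (hD : D ≤ C.comap f)
    (hB : ∀ b ∈ B, ∃ g ∈ G, (f g)⁻¹ * b ∈ C) :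
    N.relIndex B * L.relIndex D ≤ N.relIndex C * L.relIndex G := by
  have hNM : N ≤ C ⊔ N := le_sup_right
  have : (C ⊔ N).FiniteIndex := finiteIndex_of_le hNM
  have : (D ⊔ L).FiniteIndex := finiteIndex_of_le (le_sup_right : L ≤ D ⊔ L)
  have h1 : N.relIndex B ≤ N.relIndex C * (C ⊔ N).relIndex B := by
    rw [← relIndex_sup_right C N]
    have h := relIndex_inf_mul_relIndex N (C ⊔ N) B
    rw [inf_of_le_left hNM] at h
    rw [← h]
    exact Nat.mul_le_mul_right _ (relIndex_le_of_le_right inf_le_left (relIndex_ne_zero_of_finiteIndex _ _))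
  have h2 : (C ⊔ N).relIndex B ≤ (D ⊔ L).relIndex G :=
    (relIndex_le_relIndex_comap f hB le_sup_left).trans
      (relIndex_le_of_le_left (sup_le (hD.trans (comap_mono le_sup_left))
        (hL.trans (comap_mono le_sup_right))) (relIndex_ne_zero_of_finiteIndex _ _))
  have h3 : L.relIndex D * (D ⊔ L).relIndex G ≤ L.relIndex G := by
    have h := relIndex_inf_mul_relIndex L (D ⊔ L) G
    rw [inf_of_le_left (le_sup_right : L ≤ D ⊔ L)] at h
    rw [← h]
    exact Nat.mul_le_mul_right _
      (relIndex_le_of_le_right (le_inf le_sup_left hDG) (relIndex_ne_zero_of_finiteIndex _ _))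
  calc N.relIndex B * L.relIndex D
      ≤ N.relIndex C * (D ⊔ L).relIndex G * L.relIndex D := by gcongr; exact h1.trans (by gcongr)
    _ = N.relIndex C * (L.relIndex D * (D ⊔ L).relIndex G) := by ring
    _ ≤ _ := by gcongr

end Index

/-! ### Congruence quotients and first-layer decomposition. -/

variable {m : ℕ}

/-- The action of `Aut(T)` on the `n`-th layer. -/
def layerHom (m n : ℕ) : TreeAut m →* Equiv.Perm {u : List (Fin m) // u.length = n} where
  toFun a :=
    { toFun := fun u => ⟨a u.1, by rw [length_apply, u.2]⟩
      invFun := fun u => ⟨a⁻¹ u.1, by rw [length_apply, u.2]⟩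
      left_inv := fun u => Subtype.ext (inv_apply_self a u.1)
      right_inv := fun u => Subtype.ext (apply_inv_self a u.1) }
  map_one' := rfl
  map_mul' _ _ := rfl

theorem ker_layerHom (n : ℕ) : (layerHom m n).ker = layerStab m n := by
  ext a
  rw [MonoidHom.mem_ker]
  refine ⟨fun h u hu => ?_, fun h => Equiv.ext fun u => Subtype.ext (h u.1 u.2)⟩
  exact congrArg Subtype.val (Equiv.congr_fun h ⟨u, hu⟩)

instance layerStab_normal (n : ℕ) : (layerStab m n).Normal := by
  rw [← ker_layerHom]; infer_instance

instance layerStab_finiteIndex (n : ℕ) : (layerStab m n).FiniteIndex := by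
  have : Finite {u : List (Fin m) // u.length = n} := List.finite_length_eq (Fin m) n
  rw [← ker_layerHom]
  exact finiteIndex_ker _

theorem congOrder_eq_relIndex (G : Subgroup (TreeAut m)) (n : ℕ) :
    congOrder G n = (layerStab m n).relIndex G :=
  inf_relIndex_left G (layerStab m n)

theorem congOrder_pos (G : Subgroup (TreeAut m)) (n : ℕ) : 0 < congOrder G n := by
  rw [congOrder_eq_relIndex]
  exact Nat.pos_of_ne_zero (relIndex_ne_zero_of_finiteIndex _ _)

theorem congOrder_mono {G H : Subgroup (TreeAut m)} (h : G ≤ H) (n : ℕ) :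
    congOrder G n ≤ congOrder H n := by
  simp only [congOrder_eq_relIndex]
  exact relIndex_le_of_le_right h (relIndex_ne_zero_of_finiteIndex _ _)

theorem congOrder_zero (G : Subgroup (TreeAut m)) : congOrder G 0 = 1 := by
  rw [congOrder_eq_relIndex, relIndex_eq_one]
  intro g _ u hu
  rw [List.length_eq_zero_iff.1 hu, apply_nil]

theorem apply_cons (a : TreeAut m) (x : Fin m) (v : List (Fin m)) :
    a (x :: v) = label a [] x :: sec a [x] v := by
  have h := apply_append_sec a [x] v
  rwa [apply_cons_nil] at h

/-- The automorphism with trivial label at the root and sections `h x` at the vertices of the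
first layer. -/
def assemble : (Fin m → TreeAut m) →* TreeAut m where
  toFun h :=
    ⟨{ toFun := fun
        | [] => []
        | x :: v => x :: h x v
       invFun := fun
        | [] => []
        | x :: v => x :: (h x)⁻¹ v
       left_inv := by rintro (_ | ⟨x, v⟩) <;> simp [-InvMemClass.coe_inv]
       right_inv := by rintro (_ | ⟨x, v⟩) <;> simp [-InvMemClass.coe_inv] },
      by rintro (_ | ⟨x, v⟩) <;> simp [length_apply],
      by
        rintro (_ | ⟨x, u⟩) (_ | ⟨y, v⟩)
        · simp
        · simp
        · simp
        · simp only [Equiv.coe_fn_mk, List.cons_prefix_cons]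
          refine and_congr_right ?_
          rintro rfl
          exact prefix_iff _ _ _⟩
  map_one' := ext_apply (by rintro (_ | ⟨x, v⟩) <;> rfl)
  map_mul' h k := ext_apply (by rintro (_ | ⟨x, v⟩) <;> rfl)

theorem assemble_cons (h : Fin m → TreeAut m) (x : Fin m) (v : List (Fin m)) :
    assemble h (x :: v) = x :: h x v := rfl

theorem label_assemble_nil (h : Fin m → TreeAut m) : label (assemble h) [] = 1 := by
  ext x
  have h1 := apply_cons (assemble h) x []
  rw [assemble_cons] at h1
  simp at h1
  simp [← h1.1]

theorem sec_assemble (h : Fin m → TreeAut m) (x : Fin m) : sec (assemble h) [x] = h x := by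
  refine ext_apply fun v => ?_
  have h1 := apply_cons (assemble h) x v
  rw [assemble_cons] at h1
  exact (List.cons.inj h1).2.symm

theorem assemble_mem_layerStab_one (h : Fin m → TreeAut m) : assemble h ∈ layerStab m 1 := by
  intro u hu
  obtain ⟨x, rfl⟩ := List.length_eq_one_iff.1 hu
  rw [assemble_cons, apply_nil]

theorem assemble_sec {a : TreeAut m} (ha : a ∈ layerStab m 1) :
    assemble (fun x => sec a [x]) = a := by
  refine ext_apply ?_
  rintro (_ | ⟨x, v⟩)
  · rw [apply_nil, apply_nil]
  · have h1 := ha [x] rfl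
    rw [assemble_cons]
    rw [apply_cons_nil, List.cons.injEq] at h1
    rw [apply_cons, h1.1]

theorem sec_sec (a : TreeAut m) (u v : List (Fin m)) : sec (sec a u) v = sec a (u ++ v) := by
  refine ext_apply fun w => ?_
  have h := apply_append_sec a (u ++ v) w
  rw [List.append_assoc, apply_append_sec a u, apply_append_sec a u, apply_append_sec (sec a u),
    List.append_assoc] at h
  exact List.append_cancel_left (List.append_cancel_left h)

theorem label_cons (a : TreeAut m) (x : Fin m) (u : List (Fin m)) :
    label a (x :: u) = label (sec a [x]) u := by
  ext y
  simp only [label, Equiv.coe_fn_mk, sec_sec, List.singleton_append]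

/-- The sections on the first layer of the elements of `G` that fix this layer. -/
def firstSections (G : Subgroup (TreeAut m)) : Subgroup (Fin m → TreeAut m) := G.comap assemble

theorem mem_firstSections {G : Subgroup (TreeAut m)} {h : Fin m → TreeAut m} :
    h ∈ firstSections G ↔ assemble h ∈ G := Iff.rfl

theorem map_firstSections (G : Subgroup (TreeAut m)) :
    (firstSections G).map assemble = layerStab m 1 ⊓ G := by
  ext a
  constructor
  · rintro ⟨h, hh, rfl⟩
    exact ⟨assemble_mem_layerStab_one h, hh⟩
  · rintro ⟨h1, h2⟩
    exact ⟨fun x => sec a [x], by simpa [mem_firstSections, assemble_sec h1] using h2,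
      assemble_sec h1⟩

theorem comap_assemble_layerStab (n : ℕ) :
    (layerStab m (n + 1)).comap assemble = Subgroup.pi Set.univ fun _ => layerStab m n := by
  ext h
  simp only [mem_comap, mem_pi, Set.mem_univ, true_imp_iff]
  constructor
  · intro hh x u hu
    have h1 := hh (x :: u) (by simp [hu])
    rw [assemble_cons] at h1
    exact (List.cons.inj h1).2
  · rintro hh (_ | ⟨x, u⟩) hu
    · simp at hu
    · rw [assemble_cons, hh x u (by simpa using hu)]

theorem layerStab_antitone : Antitone (layerStab m) := by
  intro k n hkn a ha u hu
  -- Words are padded to length n with a letter; over an empty alphabet only the empty word exists.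
  by_cases hm : ∃ x : Fin m, True
  · obtain ⟨x, -⟩ := hm
    have h := ha (u ++ List.replicate (n - k) x) (by simp [hu]; omega)
    rw [apply_append_sec] at h
    exact List.append_inj_left h (length_apply a u)
  · match u with
    | [] => exact apply_nil a
    | x :: _ => exact absurd ⟨x, trivial⟩ hm

/-- Lagrange's theorem along St(n+1) ≤ St(1): the first factor counts the tuples of sections modulo
St(n). -/
theorem congOrder_succ (G : Subgroup (TreeAut m)) (n : ℕ) :
    congOrder G (n + 1) =
      (Subgroup.pi Set.univ fun _ => layerStab m n).relIndex (firstSections G) * congOrder G 1 := by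
  simp only [congOrder_eq_relIndex]
  rw [← comap_assemble_layerStab, relIndex_comap, map_firstSections, relIndex_inf_mul_relIndex,
    inf_of_le_left (layerStab_antitone (Nat.le_add_left 1 n))]

theorem firstSections_le_pi {G : Subgroup (TreeAut m)} (hG : SelfSimilar G) :
    firstSections G ≤ Subgroup.pi Set.univ fun _ => G := by
  intro h hh x _
  have := hG _ hh [x]
  rwa [sec_assemble] at this

theorem relIndex_pi_layerStab (G : Subgroup (TreeAut m)) (n : ℕ) :
    (Subgroup.pi Set.univ fun _ : Fin m => layerStab m n).relIndex
      (Subgroup.pi Set.univ fun _ => G) = congOrder G n ^ m := by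
  rw [relIndex_pi, congOrder_eq_relIndex, Fintype.card_fin]

instance pi_layerStab_normal (n : ℕ) :
    (Subgroup.pi Set.univ fun _ : Fin m => layerStab m n).Normal := by
  rw [← comap_assemble_layerStab]; infer_instance

instance pi_layerStab_finiteIndex (n : ℕ) :
    (Subgroup.pi Set.univ fun _ : Fin m => layerStab m n).FiniteIndex := by
  rw [← comap_assemble_layerStab]; exact finiteIndex_comap _ _

theorem congOrder_succ_le {G : Subgroup (TreeAut m)} (hG : SelfSimilar G) (n : ℕ) :
    congOrder G (n + 1) ≤ congOrder G n ^ m * congOrder G 1 := by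
  rw [congOrder_succ, ← relIndex_pi_layerStab]
  exact Nat.mul_le_mul_right _ (relIndex_le_of_le_right (firstSections_le_pi hG) (relIndex_ne_zero_of_finiteIndex _ _))

theorem firstSections_Gam (P : Subgroup (Equiv.Perm (Fin m))) :
    firstSections (Gam P) = Subgroup.pi Set.univ fun _ => Gam P := by
  ext h
  simp only [mem_firstSections, mem_pi, Set.mem_univ, true_imp_iff]
  constructor
  · intro hh x u
    have := hh (x :: u)
    rwa [label_cons, sec_assemble] at this
  · rintro hh (_ | ⟨x, u⟩)
    · rw [label_assemble_nil]; exact P.one_mem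
    · rw [label_cons, sec_assemble]; exact hh x u

/-- Sections in Γ are arbitrary and independent, so the general upper bound is attained: Γ has no
loss. -/
theorem congOrder_Gam_succ (P : Subgroup (Equiv.Perm (Fin m))) (n : ℕ) :
    congOrder (Gam P) (n + 1) = congOrder (Gam P) n ^ m * congOrder (Gam P) 1 := by
  rw [congOrder_succ, firstSections_Gam, relIndex_pi_layerStab]

/-- The label at the root, as a homomorphism. -/
def rootLabel (m : ℕ) : TreeAut m →* Equiv.Perm (Fin m) where
  toFun a := label a []
  map_one' := label_one []
  map_mul' a b := by rw [label_mul, apply_nil]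

theorem ker_rootLabel : (rootLabel m).ker = layerStab m 1 := by
  ext a
  rw [MonoidHom.mem_ker]
  constructor
  · intro h u hu
    obtain ⟨x, rfl⟩ := List.length_eq_one_iff.1 hu
    have h' : label a [] = 1 := h
    rw [apply_cons_nil, h', Equiv.Perm.one_apply]
  · intro h
    ext x
    have h1 := h [x] rfl
    rw [apply_cons_nil, List.cons.injEq] at h1
    exact congrArg Fin.val h1.1

theorem congOrder_one (G : Subgroup (TreeAut m)) :
    congOrder G 1 = Nat.card (G.map (rootLabel m)) := by
  rw [congOrder_eq_relIndex, ← ker_rootLabel, relIndex_ker]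

theorem congOrder_Gam_one_le {σ : Equiv.Perm (Fin m)} (hσ : σ.IsCycle)
    (hσ' : σ.support = Finset.univ) : congOrder (Gam (Subgroup.zpowers σ)) 1 ≤ m := by
  rw [congOrder_one]
  calc Nat.card ((Gam (Subgroup.zpowers σ)).map (rootLabel m))
      ≤ Nat.card (Subgroup.zpowers σ) := by
        refine Nat.card_le_card_of_injective (Subgroup.inclusion ?_)
          (Subgroup.inclusion_injective _)
        rintro _ ⟨a, ha, rfl⟩
        exact ha []
    _ = m := by rw [Nat.card_zpowers, hσ.orderOf, hσ', Finset.card_univ, Fintype.card_fin]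

theorem le_congOrder_one {G : Subgroup (TreeAut m)} (hm : 0 < m) (hG : SphericallyTransitive G) :
    m ≤ congOrder G 1 := by
  rw [congOrder_one]
  conv_lhs => rw [← Nat.card_fin m]
  refine Nat.card_le_card_of_surjective
    (fun π : G.map (rootLabel m) => π.1 (⟨0, hm⟩ : Fin m)) fun x => ?_
  obtain ⟨g, hg, hgx⟩ := hG [⟨0, hm⟩] [x] rfl
  rw [apply_cons_nil] at hgx
  exact ⟨⟨_, g, hg, rfl⟩, (List.cons.inj hgx).1⟩

/-! ### The maps β_i on sections, labels and layers. -/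

theorem beta_mem_Bas {s i : ℕ} (hi : i < s) {G : Subgroup (TreeAut m)} {g : TreeAut m}
    (hg : g ∈ G) : beta s i g ∈ Bas s G :=
  subset_closure ⟨i, hi, g, hg, rfl⟩

theorem beta_zero_apply_cons (s : ℕ) (g : TreeAut m) (x : Fin m) (v : List (Fin m)) :
    beta s 0 g (x :: v) = label g [] x :: beta s (s - 1) (sec g [x]) v := rfl

theorem label_nil_eq_of_apply_cons {a : TreeAut m} {π : Fin m → Fin m} {h : Fin m → TreeAut m}
    (H : ∀ x v, a (x :: v) = π x :: h x v) (x : Fin m) : label a [] x = π x := by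
  have h1 := H x []
  rw [apply_cons] at h1
  exact (List.cons.inj h1).1

theorem sec_eq_of_apply_cons {a : TreeAut m} {π : Fin m → Fin m} {h : Fin m → TreeAut m}
    (H : ∀ x v, a (x :: v) = π x :: h x v) (x : Fin m) : sec a [x] = h x := by
  refine ext_apply fun v => ?_
  have h1 := H x v
  rw [apply_cons] at h1
  exact (List.cons.inj h1).2

theorem label_beta_zero (s : ℕ) (g : TreeAut m) : label (beta s 0 g) [] = label g [] :=
  Equiv.ext (label_nil_eq_of_apply_cons (beta_zero_apply_cons s g))

theorem sec_beta_zero (s : ℕ) (g : TreeAut m) (x : Fin m) :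
    sec (beta s 0 g) [x] = beta s (s - 1) (sec g [x]) :=
  sec_eq_of_apply_cons (beta_zero_apply_cons s g) x

theorem layerStab_one_iff {a : TreeAut m} : a ∈ layerStab m 1 ↔ label a [] = 1 := by
  rw [← ker_rootLabel]; rfl

theorem beta_zero_eq_assemble (s : ℕ) {g : TreeAut m} (hg : g ∈ layerStab m 1) :
    beta s 0 g = assemble fun x => beta s (s - 1) (sec g [x]) := by
  rw [← assemble_sec (a := beta s 0 g)]
  · simp only [sec_beta_zero]
  · rw [layerStab_one_iff] at hg ⊢
    rw [label_beta_zero, hg]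

theorem beta_succ_eq_assemble (s i : ℕ) (hm : 0 < m) (g : TreeAut m) :
    beta s (i + 1) g = assemble (Pi.mulSingle ⟨0, hm⟩ (beta s i g)) := by
  refine ext_apply ?_
  rintro (_ | ⟨x, v⟩)
  · rw [apply_nil, apply_nil]
  · rw [assemble_cons]
    change (if (x : ℕ) = 0 then x :: betaFun s i g v else x :: v) = _
    split_ifs with hx
    · obtain rfl : x = ⟨0, hm⟩ := Fin.ext hx
      rw [Pi.mulSingle_eq_same]; rfl
    · rw [Pi.mulSingle_eq_of_ne (fun h => hx (by rw [h])), one_apply]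

/-- Conjugation by `t` transports an element supported below `x` to the subtree below `t(x)`; this
spreads the β_i, supported below the vertex 0, to every vertex. -/
theorem mul_assemble_mulSingle_mul_inv (t : TreeAut m) (x : Fin m) (a : TreeAut m) :
    t * assemble (Pi.mulSingle x a) * t⁻¹ =
      assemble (Pi.mulSingle (label t [] x) (sec t [x] * a * (sec t [x])⁻¹)) := by
  rw [mul_inv_eq_iff_eq_mul]
  refine ext_apply ?_
  rintro (_ | ⟨y, v⟩)
  · rw [apply_nil, apply_nil]
  · rw [mul_apply, mul_apply, assemble_cons, apply_cons, apply_cons, assemble_cons]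
    by_cases hy : y = x
    · subst hy
      rw [Pi.mulSingle_eq_same, Pi.mulSingle_eq_same, ← mul_apply, ← mul_apply,
        inv_mul_cancel_right]
    · rw [Pi.mulSingle_eq_of_ne hy, Pi.mulSingle_eq_of_ne
        ((label t []).injective.ne hy), one_apply, one_apply]

theorem label_beta_mem (s : ℕ) {P : Subgroup (Equiv.Perm (Fin m))} (u : List (Fin m)) :
    ∀ (i : ℕ) (g : TreeAut m), g ∈ Gam P → label (beta s i g) u ∈ P := by
  induction u with
  | nil =>
    rintro (_ | i) g hg
    · rw [label_beta_zero]; exact hg []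
    · by_cases hm : 0 < m
      · rw [beta_succ_eq_assemble s i hm, label_assemble_nil]; exact P.one_mem
      · obtain rfl : m = 0 := by omega
        rw [Subsingleton.elim (label _ _) 1]; exact P.one_mem
  | cons x u ih =>
    rintro (_ | i) g hg
    · rw [label_cons, sec_beta_zero]
      refine ih _ _ fun v => ?_
      rw [← label_cons]; exact hg _
    · rw [beta_succ_eq_assemble s i (Nat.zero_lt_of_lt x.2), label_cons, sec_assemble]
      by_cases hx : x = ⟨0, Nat.zero_lt_of_lt x.2⟩
      · rw [hx, Pi.mulSingle_eq_same]; exact ih _ _ hg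
      · rw [Pi.mulSingle_eq_of_ne hx, label_one]; exact P.one_mem

theorem Bas_le_Gam (s : ℕ) {P : Subgroup (Equiv.Perm (Fin m))} {G : Subgroup (TreeAut m)}
    (hG : G ≤ Gam P) : Bas s G ≤ Gam P := by
  rw [Bas, closure_le]
  rintro _ ⟨i, -, g, hg, rfl⟩ u
  exact label_beta_mem s u i g (hG hg)

theorem sec_mem_layerStab {g : TreeAut m} {n : ℕ} (hg : g ∈ layerStab m (n + 1)) (x : Fin m) :
    sec g [x] ∈ layerStab m n := by
  intro u hu
  have h := hg (x :: u) (by simp [hu])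
  rw [apply_cons] at h
  exact (List.cons.inj h).2

/-- β_i delays the action by i layers, and afterwards each layer consumed by `g` costs s layers: one
for β_0 and s - 1 for the delay of β_{s-1}. -/
theorem betaFun_eq_self {s : ℕ} (hs : 0 < s) (v : List (Fin m)) : ∀ (i j : ℕ) (g : TreeAut m),
    g ∈ layerStab m j → v.length ≤ s * j + i → betaFun s i g v = v := by
  induction v with
  | nil => intro i j g _ _; simp [betaFun]
  | cons x v ih =>
    rintro (_ | i) j g hg hv
    · obtain _ | j := j
      · simp at hv
      · have h1 := layerStab_one_iff.1 (layerStab_antitone (Nat.le_add_left 1 j) hg)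
        have h2 : s * (j + 1) = s * j + s := by ring
        rw [betaFun, h1, ih _ _ _ (sec_mem_layerStab hg x)
          (by simp only [List.length_cons] at hv; omega)]
        rfl
    · rw [betaFun, ih i j g hg (by simp only [List.length_cons] at hv; omega), ite_self]

theorem layerStab_le_comap_beta {s : ℕ} (hs : 0 < s) (n : ℕ) :
    layerStab m (n / s) ≤ (layerStab m n).comap (beta s (s - 1)) := by
  intro g hg u hu
  refine betaFun_eq_self hs u _ _ g hg ?_
  have h1 := Nat.div_add_mod n s
  have h2 := Nat.mod_lt n hs
  omega

/-! ### Sections of the Basilica group and its loss per level. -/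

section Fractal

variable {s : ℕ} {G : Subgroup (TreeAut m)}

/-- Fractality of G lifts through β_0 and yields the generators β_{s-1}(g). The others come from
conjugates of β_{i+1}(g) by some β_0(k); the resulting conjugation by an element β_{s-1}(k') is
undone inside the projection. -/
theorem exists_mem_firstSections_Bas (hm : 0 < m) (hs : 0 < s) (hvsf : VeryStronglyFractal G)
    (hss : SelfSimilar G) (x : Fin m) {b : TreeAut m} (hb : b ∈ Bas s G) :
    ∃ h ∈ firstSections (Bas s G), h x = b := by
  suffices H : Bas s G ≤ (firstSections (Bas s G)).map (Pi.evalMonoidHom _ x) from H hb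
  have hlast : ∀ g ∈ G, beta s (s - 1) g ∈ (firstSections (Bas s G)).map (Pi.evalMonoidHom _ x) := by
    intro g hg
    have h1 : g ∈ (St G 0 : Set (TreeAut m)) :=
      ⟨hg, fun u hu => by rw [List.length_eq_zero_iff.1 hu, apply_nil]⟩
    rw [← hvsf.2 0 x] at h1
    obtain ⟨k, hk, rfl⟩ := h1
    refine ⟨fun y => beta s (s - 1) (sec k [y]), ?_, rfl⟩
    change assemble _ ∈ Bas s G
    rw [← beta_zero_eq_assemble s hk.2]
    exact beta_mem_Bas hs hk.1
  rw [Bas, closure_le]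
  rintro _ ⟨i, hi, g, hg, rfl⟩
  rw [← Bas]
  by_cases his : i = s - 1
  · rw [his]; exact hlast g hg
  obtain ⟨k, hk, hkx⟩ := hvsf.1 [⟨0, hm⟩] [x] rfl
  have hk' : label k [] ⟨0, hm⟩ = x := by
    rw [apply_cons_nil] at hkx; exact (List.cons.inj hkx).1
  have h1 : assemble (Pi.mulSingle x (beta s (s - 1) (sec k [⟨0, hm⟩]) * beta s i g *
      (beta s (s - 1) (sec k [⟨0, hm⟩]))⁻¹)) ∈ Bas s G := by
    have := mul_assemble_mulSingle_mul_inv (beta s 0 k) ⟨0, hm⟩ (beta s i g)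
    rw [label_beta_zero, hk', sec_beta_zero, ← beta_succ_eq_assemble] at this
    rw [← this]
    exact mul_mem (mul_mem (beta_mem_Bas hs hk) (beta_mem_Bas (by omega) hg))
      (inv_mem (beta_mem_Bas hs hk))
  have h2 := mem_map_of_mem (Pi.evalMonoidHom _ x) (mem_firstSections.2 h1)
  rw [Pi.evalMonoidHom_apply, Pi.mulSingle_eq_same] at h2
  have h3 := hlast _ (hss k hk [⟨0, hm⟩])
  have h4 := mul_mem (mul_mem (inv_mem h3) h2) h3
  simpa [mul_assoc] using h4

/-- The elements `a` for which the automorphism with section `a` at the vertex `x` of the first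
layer and trivial action elsewhere lies in `G`. -/
def rigidSections (G : Subgroup (TreeAut m)) (x : Fin m) : Subgroup (TreeAut m) :=
  G.comap (assemble.comp (MonoidHom.mulSingle (fun _ => TreeAut m) x))

theorem mem_rigidSections {x : Fin m} {a : TreeAut m} :
    a ∈ rigidSections G x ↔ assemble (Pi.mulSingle x a) ∈ G := Iff.rfl

/-- St_Bas(1) projects onto all of Bas at `x`, so conjugation by `b` is realised inside Bas. -/
theorem conj_mem_rigidSections (hm : 0 < m) (hs : 0 < s) (hvsf : VeryStronglyFractal G)
    (hss : SelfSimilar G) (x : Fin m) {a b : TreeAut m} (ha : a ∈ rigidSections (Bas s G) x)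
    (hb : b ∈ Bas s G) : b * a * b⁻¹ ∈ rigidSections (Bas s G) x := by
  obtain ⟨h, hh, rfl⟩ := exists_mem_firstSections_Bas hm hs hvsf hss x hb
  have h1 := mul_assemble_mulSingle_mul_inv (assemble h) x a
  rw [label_assemble_nil, sec_assemble, Equiv.Perm.one_apply] at h1
  rw [mem_rigidSections, ← h1]
  exact mul_mem (mul_mem hh ha) (inv_mem hh)

theorem beta_mem_rigidSections (hm : 0 < m) (hs : 0 < s) (hvsf : VeryStronglyFractal G)
    (hss : SelfSimilar G) (x : Fin m) {i : ℕ} (hi : i + 1 < s) {g : TreeAut m} (hg : g ∈ G) :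
    beta s i g ∈ rigidSections (Bas s G) x := by
  obtain ⟨k, hk, hkx⟩ := hvsf.1 [⟨0, hm⟩] [x] rfl
  have hk' : label k [] ⟨0, hm⟩ = x := by
    rw [apply_cons_nil] at hkx; exact (List.cons.inj hkx).1
  have h1 := mul_assemble_mulSingle_mul_inv (beta s 0 k) ⟨0, hm⟩ (beta s i g)
  rw [label_beta_zero, hk', sec_beta_zero, ← beta_succ_eq_assemble] at h1
  have h2 : beta s (s - 1) (sec k [⟨0, hm⟩]) * beta s i g *
      (beta s (s - 1) (sec k [⟨0, hm⟩]))⁻¹ ∈ rigidSections (Bas s G) x := by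
    rw [mem_rigidSections, ← h1]
    exact mul_mem (mul_mem (beta_mem_Bas hs hk) (beta_mem_Bas hi hg))
      (inv_mem (beta_mem_Bas hs hk))
  have h3 := conj_mem_rigidSections hm hs hvsf hss x h2
    (inv_mem (beta_mem_Bas (i := s - 1) (by omega) (hss k hk [⟨0, hm⟩])))
  simpa [mul_assoc] using h3

/-- The rigid sections are normalised by Bas and contain β_i(G) for i < s - 1, so modulo them only
β_{s-1}(G) survives. -/
theorem exists_beta_inv_mul_mem_rigidSections (hm : 0 < m) (hs : 0 < s)
    (hvsf : VeryStronglyFractal G) (hss : SelfSimilar G) (x : Fin m) {b : TreeAut m}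
    (hb : b ∈ Bas s G) :
    ∃ g ∈ G, (beta s (s - 1) g)⁻¹ * b ∈ rigidSections (Bas s G) x := by
  have hβ : ∀ g ∈ G, beta s (s - 1) g ∈ Bas s G := fun g hg => beta_mem_Bas (by omega) hg
  induction hb using closure_induction with
  | mem _ h =>
    obtain ⟨i, hi, g, hg, rfl⟩ := h
    by_cases his : i = s - 1
    · exact ⟨g, hg, by rw [his, inv_mul_cancel]; exact one_mem _⟩
    · exact ⟨1, G.one_mem, by
        rw [map_one, inv_one, one_mul]
        exact beta_mem_rigidSections hm hs hvsf hss x (by omega) hg⟩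
  | one => exact ⟨1, G.one_mem, by simp⟩
  | mul a b _ _ iha ihb =>
    obtain ⟨g, hg, hga⟩ := iha
    obtain ⟨k, hk, hkb⟩ := ihb
    refine ⟨g * k, G.mul_mem hg hk, ?_⟩
    -- With β = β_{s-1}: β(gk)⁻¹ab = β(k)⁻¹(β(g)⁻¹a)β(k) · β(k)⁻¹b.
    have := mul_mem (conj_mem_rigidSections hm hs hvsf hss x hga (inv_mem (hβ k hk))) hkb
    simpa [mul_assoc] using this
  | inv a _ iha =>
    obtain ⟨g, hg, hga⟩ := iha
    refine ⟨g⁻¹, G.inv_mem hg, ?_⟩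
    have := conj_mem_rigidSections hm hs hvsf hss x (inv_mem hga) (hβ g hg)
    simpa [mul_assoc] using this

theorem pi_mem_firstSections_of_mem_rigidSections {H : Subgroup (TreeAut m)}
    {h : Fin m → TreeAut m} (hh : ∀ x, h x ∈ rigidSections H x) : h ∈ firstSections H :=
  pi_mem_of_mulSingle_mem h hh

/-- The homomorphism `β_i` applied in each coordinate. -/
def betaPi (m s i : ℕ) : (Fin m → TreeAut m) →* (Fin m → TreeAut m) where
  toFun h x := beta s i (h x)
  map_one' := funext fun _ => map_one _
  map_mul' _ _ := funext fun _ => map_mul _ _ _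

/-- In logarithms: the loss of Bas at step n is at most the loss of G at step ⌊n/s⌋. -/
theorem congOrder_Bas_succ (hm : 0 < m) (hs : 0 < s) (hvsf : VeryStronglyFractal G)
    (hss : SelfSimilar G) (n : ℕ) :
    congOrder (Bas s G) n ^ m * congOrder G (n / s + 1) ≤
      congOrder (Bas s G) (n + 1) * congOrder G (n / s) ^ m := by
  have h1 : congOrder G 1 ≤ congOrder (Bas s G) 1 := by
    rw [congOrder_one, congOrder_one]
    refine Nat.card_le_card_of_injective (Subgroup.inclusion ?_) (Subgroup.inclusion_injective _)
    rintro _ ⟨g, hg, rfl⟩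
    exact ⟨beta s 0 g, beta_mem_Bas hs hg, label_beta_zero s g⟩
  have h2 := relIndex_mul_le (f := betaPi m s (s - 1)) (G := Subgroup.pi Set.univ fun _ => G)
    (D := firstSections G) (L := Subgroup.pi Set.univ fun _ => layerStab m (n / s))
    (B := Subgroup.pi Set.univ fun _ => Bas s G) (C := firstSections (Bas s G))
    (N := Subgroup.pi Set.univ fun _ => layerStab m n)
    (firstSections_le_pi hss)
    (fun h hh x _ => layerStab_le_comap_beta hs n (hh x trivial))
    (fun h hh => by
      have h3 := beta_zero_eq_assemble s (assemble_mem_layerStab_one h)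
      simp only [sec_assemble] at h3
      change assemble (fun x => beta s (s - 1) (h x)) ∈ Bas s G
      rw [← h3]
      exact beta_mem_Bas hs hh)
    (fun b hb => by
      choose g hg hgb using fun x =>
        exists_beta_inv_mul_mem_rigidSections hm hs hvsf hss x (hb x trivial)
      exact ⟨g, fun x _ => hg x, pi_mem_firstSections_of_mem_rigidSections hgb⟩)
  rw [relIndex_pi_layerStab, relIndex_pi_layerStab] at h2
  rw [congOrder_succ (Bas s G) n, congOrder_succ G (n / s)]
  calc _ = _ * congOrder G 1 := (mul_assoc _ _ _).symm
    _ ≤ _ * congOrder (Bas s G) 1 := Nat.mul_le_mul h2 h1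
    _ = _ := by ring

end Fractal

open Filter Topology

/-! ### Real sequences: comparing the deficits. -/

section Growth

variable {M : ℝ} {d b γ : ℕ → ℝ} {s : ℕ}

/-- The constant 3/4 is attained at M = s = 2, j = 1. -/
theorem block_coefficient_le (hM : 2 ≤ M) (hs : 2 ≤ s) {j : ℕ} (hj : 1 ≤ j) :
    (1 - (M ^ s)⁻¹) / (M - 1) / M ^ (s * j) ≤ 3 / 4 / M ^ (j + 1) := by
  obtain ⟨k, rfl⟩ : ∃ k, s = k + 2 := ⟨s - 2, by omega⟩
  obtain ⟨l, rfl⟩ : ∃ l, j = l + 1 := ⟨j - 1, by omega⟩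
  have hM0 : 0 < M := by linarith
  have hM1 : 0 < M - 1 := by linarith
  have hp : 1 ≤ M ^ k := one_le_pow₀ (by linarith)
  have hq : 1 ≤ M ^ (l * (k + 1)) := one_le_pow₀ (by linarith)
  have e1 : M ^ (k + 2) = M ^ k * M ^ 2 := pow_add _ _ _
  have e2 : M ^ ((k + 2) * (l + 1)) = M ^ (l + 1 + 1) * M ^ k * M ^ (l * (k + 1)) := by
    rw [← pow_add, ← pow_add]; congr 1; ring
  rw [e1, e2]
  set p := M ^ k
  set q := M ^ (l * (k + 1))
  set r := M ^ (l + 1 + 1)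
  have hr : 0 < r := by positivity
  have key : (1 - (p * M ^ 2)⁻¹) / (M - 1) ≤ 3 / 4 * p := by
    have h0 : 0 < p * M ^ 2 := by positivity
    have h1 : 1 - (p * M ^ 2)⁻¹ = (p * M ^ 2 - 1) / (p * M ^ 2) := by field_simp
    rw [h1, div_div, div_le_iff₀ (by positivity)]
    -- After clearing denominators the difference of the two sides is its value at p = 1 (`h2`) plus
    -- a multiple of p - 1 (`h3`).
    have h2 : 0 ≤ (M - 2) * (3 / 4 * M ^ 2 - M / 4 - 1 / 2) :=
      mul_nonneg (by linarith) (by nlinarith)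
    have h3 : 0 ≤ (p - 1) * M ^ 2 * (3 / 4 * ((M - 1) * (p + 1)) - 1) :=
      mul_nonneg (mul_nonneg (by linarith) (by positivity)) (by nlinarith)
    linarith
  calc (1 - (p * M ^ 2)⁻¹) / (M - 1) / (r * p * q) ≤ 3 / 4 * p / (r * p * q) := by gcongr
    _ ≤ 3 / 4 * p / (r * p * 1) := by gcongr
    _ = 3 / 4 / r := by field_simp

/-- The coefficient of `o` is the geometric sum M^{-(a+1)} + … + M^{-(a+r)}. -/
theorem defect_block_le (hM : 1 < M) {f : ℕ → ℝ} {o : ℝ} {a s : ℕ}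
    (hf : ∀ r < s, f (a + r + 1) ≤ f (a + r) + o / M ^ (a + r + 1)) :
    ∀ r ≤ s, f (a + r) ≤ f a + o * ((1 - (M ^ r)⁻¹) / (M - 1) / M ^ a)
  | 0, _ => by simp
  | r + 1, hr => by
    have h1 := defect_block_le hM hf r (by omega)
    have h2 := hf r (by omega)
    have hM0 : 0 < M := by linarith
    have hM1 : M - 1 ≠ 0 := by linarith
    have h3 : (1 - (M ^ r)⁻¹) / (M - 1) / M ^ a + 1 / M ^ (a + r + 1) =
        (1 - (M ^ (r + 1))⁻¹) / (M - 1) / M ^ a := by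
      rw [pow_succ M (a + r), pow_succ, pow_add]
      field_simp
      ring
    rw [← h3, ← add_assoc]
    calc _ ≤ _ := h2
      _ ≤ _ := by rw [mul_add, mul_one_div, ← add_assoc]; gcongr

theorem defect_succ (hM : 1 < M) (hγ : ∀ n, γ (n + 1) = M * γ n + 1) (n : ℕ) :
    (γ (n + 1) - d (n + 1)) / M ^ (n + 1) =
      (γ n - d n) / M ^ n + (M * d n + 1 - d (n + 1)) / M ^ (n + 1) := by
  have hM0 : 0 < M := by linarith
  rw [hγ, pow_succ]
  field_simp
  ring

/-- On the block sj ≤ n < s(j+1) the quotient n / s is constant, so all increments are charged to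
the same loss of d; the block bounds then telescope. -/
theorem defect_le (hM : 2 ≤ M) (hs : 2 ≤ s) (hγ0 : γ 0 = 0) (hd0 : d 0 = 0) (hb0 : b 0 = 0)
    (hd1 : d 1 = 1) (hγ : ∀ n, γ (n + 1) = M * γ n + 1) (hd : ∀ n, d (n + 1) ≤ M * d n + 1)
    (hb : ∀ n, M * b n + d (n / s + 1) ≤ b (n + 1) + M * d (n / s)) (n : ℕ) :
    (γ n - b n) / M ^ n ≤ 3 / 4 * ((γ (n / s + 1) - d (n / s + 1)) / M ^ (n / s + 1)) := by
  set f : ℕ → ℝ := fun n => (γ n - b n) / M ^ n with hf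
  set e : ℕ → ℝ := fun n => (γ n - d n) / M ^ n with he
  have hM0 : 0 < M := by linarith
  have hM1 : 1 < M := by linarith
  have hblock : ∀ j, ∀ r ≤ s, f (s * j + r) ≤ f (s * j) + 3 / 4 * (e (j + 1) - e j) := by
    intro j r hr
    have h1 : f (s * j + r) ≤ _ := defect_block_le (f := f) (a := s * j)
      (o := M * d j + 1 - d (j + 1)) hM1 (s := s) (fun r hr => by
        have h1 : (s * j + r) / s = j := by
          rw [Nat.mul_add_div (by omega), Nat.div_eq_of_lt hr, add_zero]
        have h2 := hb (s * j + r)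
        rw [h1] at h2
        simp only [hf]
        rw [defect_succ hM1 hγ]
        refine add_le_add le_rfl (div_le_div_of_nonneg_right ?_ (by positivity))
        linarith only [h2]) r hr
    refine h1.trans ?_
    have h2 : e (j + 1) - e j = (M * d j + 1 - d (j + 1)) / M ^ (j + 1) := by
      simp only [he]; rw [defect_succ hM1 hγ, add_sub_cancel_left]
    rw [h2]
    -- The coefficient bound fails at j = 0, but there the loss M·d 0 + 1 - d 1 vanishes.
    obtain rfl | hj := Nat.eq_zero_or_pos j
    · simp [hd0, hd1]
    have h3 : (1 - (M ^ r)⁻¹) / (M - 1) / M ^ (s * j) ≤ 3 / 4 / M ^ (j + 1) := by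
      refine le_trans ?_ (block_coefficient_le hM hs hj)
      have : 0 < M - 1 := by linarith
      gcongr
      linarith
    have h4 := mul_le_mul_of_nonneg_left h3 (sub_nonneg.2 (hd j))
    calc _ ≤ _ := add_le_add_right h4 (f (s * j))
      _ = _ := by ring
  have hmul : ∀ j, f (s * j) ≤ 3 / 4 * e j := by
    intro j
    induction j with
    | zero => simp [hf, he, hγ0, hb0, hd0]
    | succ j ih =>
      have h := hblock j s le_rfl
      rw [← Nat.mul_add_one] at h
      linarith
  have h1 := hblock (n / s) (n % s) (Nat.mod_lt n (by omega)).le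
  rw [Nat.div_add_mod] at h1
  have h2 := hmul (n / s)
  change f n ≤ 3 / 4 * e (n / s + 1)
  linarith

theorem liminf_div_lt_liminf_div (hM : 2 ≤ M) (hs : 2 ≤ s) (hγ0 : γ 0 = 0) (hd0 : d 0 = 0)
    (hb0 : b 0 = 0) (hd1 : d 1 = 1) (hγ : ∀ n, γ (n + 1) = M * γ n + 1)
    (hd : ∀ n, d (n + 1) ≤ M * d n + 1)
    (hb : ∀ n, M * b n + d (n / s + 1) ≤ b (n + 1) + M * d (n / s))
    (hdnn : ∀ n, 0 ≤ d n) (hbγ : ∀ n, b n ≤ γ n)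
    (hlt : liminf (fun n => d n / γ n) atTop < 1) :
    liminf (fun n => d n / γ n) atTop < liminf (fun n => b n / γ n) atTop := by
  have hM0 : 0 < M := by linarith
  have hM1 : 1 < M := by linarith
  have hM' : 0 < M - 1 := by linarith
  have hγeq : ∀ n, γ n = (M ^ n - 1) / (M - 1) := by
    intro n
    induction n with
    | zero => simp [hγ0]
    | succ n ih => rw [hγ, ih, pow_succ]; field_simp; ring
  have hγpos : ∀ n, 1 ≤ n → 0 < γ n := by
    intro n hn
    rw [hγeq]
    have : 1 < M ^ n := one_lt_pow₀ hM1 (by omega)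
    exact div_pos (by linarith) hM'
  set e : ℕ → ℝ := fun n => (γ n - d n) / M ^ n with he
  have hmono : Monotone e := by
    refine monotone_nat_of_le_succ fun n => ?_
    simp only [he]
    rw [defect_succ hM1 hγ]
    have := sub_nonneg.2 (hd n)
    have : 0 ≤ (M * d n + 1 - d (n + 1)) / M ^ (n + 1) := by positivity
    linarith
  have hbdd : BddAbove (Set.range e) := by
    refine ⟨1 / (M - 1), ?_⟩
    rintro _ ⟨n, rfl⟩
    simp only [he]
    have h1 : 0 < M ^ n := by positivity
    have h2 : γ n ≤ M ^ n / (M - 1) := by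
      rw [hγeq]
      gcongr
      linarith
    rw [div_le_iff₀ h1, one_div, inv_mul_eq_div]
    linarith [hdnn n]
  set E := ⨆ n, e n with hE
  have hlim : Tendsto e atTop (𝓝 E) := tendsto_atTop_ciSup hmono hbdd
  have hratio : Tendsto (fun n => M ^ n / γ n) atTop (𝓝 (M - 1)) := by
    have h1 : Tendsto (fun n : ℕ => (M⁻¹) ^ n) atTop (𝓝 0) :=
      tendsto_pow_atTop_nhds_zero_of_lt_one (by positivity) (inv_lt_one_of_one_lt₀ hM1)
    have h2 : Tendsto (fun n : ℕ => (M - 1) / (1 - (M⁻¹) ^ n)) atTop (𝓝 ((M - 1) / (1 - 0))) :=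
      tendsto_const_nhds.div (tendsto_const_nhds.sub h1) (by norm_num)
    rw [sub_zero, div_one] at h2
    refine h2.congr' ?_
    filter_upwards [eventually_ge_atTop 1] with n hn
    have h3 : 1 < M ^ n := one_lt_pow₀ hM1 (by omega)
    have h4 : M ^ n - 1 ≠ 0 := by linarith
    rw [hγeq, inv_pow]
    have h5 : 1 - (M ^ n)⁻¹ = (M ^ n - 1) / M ^ n := by field_simp
    rw [h5]
    field_simp
  have hdlim : Tendsto (fun n => d n / γ n) atTop (𝓝 (1 - E * (M - 1))) := by
    refine (tendsto_const_nhds.sub (hlim.mul hratio)).congr' ?_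
    filter_upwards [eventually_ge_atTop 1] with n hn
    have := hγpos n hn
    simp only [he]
    field_simp
    ring
  rw [hdlim.liminf_eq] at hlt ⊢
  have hEpos : 0 < E := by nlinarith
  have hwlim : Tendsto (fun n => 1 - 3 / 4 * E * (M ^ n / γ n)) atTop
      (𝓝 (1 - 3 / 4 * E * (M - 1))) :=
    tendsto_const_nhds.sub (tendsto_const_nhds.mul hratio)
  calc 1 - E * (M - 1) < 1 - 3 / 4 * E * (M - 1) := by nlinarith [mul_pos hEpos hM']
    _ = liminf (fun n => 1 - 3 / 4 * E * (M ^ n / γ n)) atTop := hwlim.liminf_eq.symm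
    _ ≤ liminf (fun n => b n / γ n) atTop := by
      refine liminf_le_liminf ?_ hwlim.isBoundedUnder_ge ?_
      · filter_upwards [eventually_ge_atTop 1] with n hn
        have h1 : (γ n - b n) / M ^ n ≤ 3 / 4 * E :=
          (defect_le hM hs hγ0 hd0 hb0 hd1 hγ hd hb n).trans
            (mul_le_mul_of_nonneg_left (le_ciSup hbdd (n / s + 1)) (by norm_num))
        have h2 := hγpos n hn
        have h3 : 0 < M ^ n := by positivity
        rw [div_le_iff₀ h3] at h1
        rw [le_div_iff₀ h2, sub_mul, one_mul, mul_assoc, div_mul_cancel₀ _ h2.ne']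
        linarith
      -- A real liminf is meaningful only for suitably bounded sequences; b ≤ γ supplies the upper
      -- bound.
      · refine IsBoundedUnder.isCoboundedUnder_ge
          (isBoundedUnder_of_eventually_le (a := 1) ?_)
        filter_upwards [eventually_ge_atTop 1] with n hn
        exact (div_le_one (hγpos n hn)).2 (hbγ n)

end Growth

end Basilica

/-! ### From group orders to logarithms. -/

theorem corollary1p5 (m s : ℕ) (hm : 1 < m) (hs : 1 < s)
    (σ : Equiv.Perm (Fin m)) (hσ : σ.IsCycle) (hσ' : σ.support = Finset.univ)
    (G : Subgroup (Basilica.TreeAut m))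
    (hΓ : G ≤ Basilica.Gam (Subgroup.zpowers σ))
    (hvsf : Basilica.VeryStronglyFractal G)
    (hss : Basilica.SelfSimilar G)
    (hbranch : Basilica.WeaklyRegularBranchOver G (Basilica.splitK s G (s - 1)))
    (hdim : Basilica.dimH (Basilica.Gam (Subgroup.zpowers σ)) G < 1) :
    Basilica.dimH (Basilica.Gam (Subgroup.zpowers σ)) G <
      Basilica.dimH (Basilica.Gam (Subgroup.zpowers σ)) (Basilica.Bas s G) := by
  have hm1 : (1 : ℝ) < m := by exact_mod_cast hm
  -- Transitivity gives at least m and the cyclic label group at most m; hence d_1 = γ_1 = 1.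
  have hG1 : Basilica.congOrder G 1 = m ∧
      Basilica.congOrder (Basilica.Gam (Subgroup.zpowers σ)) 1 = m := by
    have h1 := Basilica.le_congOrder_one (by omega) hvsf.1
    have h2 := Basilica.congOrder_Gam_one_le hσ hσ'
    have h3 := Basilica.congOrder_mono hΓ 1
    omega
  have hpos : ∀ (H : Subgroup (Basilica.TreeAut m)) (n : ℕ),
      (0 : ℝ) < Basilica.congOrder H n := fun H n => by
    exact_mod_cast Basilica.congOrder_pos H n
  have hlog : ∀ (H K : Subgroup (Basilica.TreeAut m)) (k n : ℕ),
      Real.logb m ((Basilica.congOrder H n : ℝ) ^ m * Basilica.congOrder K k) =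
        m * Real.logb m (Basilica.congOrder H n) + Real.logb m (Basilica.congOrder K k) := by
    intro H K k n
    rw [Real.logb_mul (pow_ne_zero _ (hpos H n).ne') (hpos K k).ne', Real.logb_pow]
  have hzero : ∀ H : Subgroup (Basilica.TreeAut m),
      Real.logb m (Basilica.congOrder H 0) = 0 := fun H => by
    rw [Basilica.congOrder_zero, Nat.cast_one, Real.logb_one]
  have hGlog : Real.logb m (Basilica.congOrder G 1) = 1 := by
    rw [hG1.1, Real.logb_self_eq_one hm1]
  have hΓlog : Real.logb m (Basilica.congOrder (Basilica.Gam (Subgroup.zpowers σ)) 1) = 1 := by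
    rw [hG1.2, Real.logb_self_eq_one hm1]
  refine Basilica.liminf_div_lt_liminf_div (M := m) (s := s) (by exact_mod_cast hm) hs
    (hzero _) (hzero _) (hzero _) hGlog (fun n => ?_) (fun n => ?_) (fun n => ?_)
    (fun n => ?_) (fun n => ?_) hdim
  · rw [Basilica.congOrder_Gam_succ]
    push_cast
    rw [hlog, hΓlog]
  · rw [← hGlog, ← hlog]
    refine Real.logb_le_logb_of_le hm1 (hpos _ _) ?_
    exact_mod_cast Basilica.congOrder_succ_le hss n
  · rw [add_comm (Real.logb m (Basilica.congOrder (Basilica.Bas s G) (n + 1))), ← hlog, ← hlog]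
    refine Real.logb_le_logb_of_le hm1 (mul_pos (pow_pos (hpos _ _) _) (hpos _ _)) ?_
    have := Basilica.congOrder_Bas_succ (s := s) (by omega) (by omega) hvsf hss n
    rw [mul_comm (Basilica.congOrder (Basilica.Bas s G) (n + 1))] at this
    exact_mod_cast this
  · exact Real.logb_nonneg hm1 (by exact_mod_cast Basilica.congOrder_pos G n)
  · refine Real.logb_le_logb_of_le hm1 (hpos _ _) ?_
    exact_mod_cast Basilica.congOrder_mono (Basilica.Bas_le_Gam s hΓ) n
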